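/- **Parametrisation.** For $S$ a $d\times d$ positive definite matrix and $\nu>0$, $\mathcal T_d(\xi,S,\nu)$ denotes the multivariate $t$ distribution on $\mathbb R^d$ with density $$\frac{\Gamma\{(\nu+d)/2\}}{\Gamma(\nu/2)(\pi\nu)^{d/2}}\,|S|^{-1/2}\Big\{1+\tfrac1\nu(x-\xi)^\top S^{-1}(x-\xi)\Big\}^{-(\nu+d)/2}.$$ Given $\xi\in\mathbb R^d$, a $d\times d$ matrix $\Omega$, a $d\times m$ matrix $\Delta$, $\tau\in\mathbb R^m$, an $m\times m$ matrix $\bar\Gamma$ with unit diagonal and $\nu>0$, put $\omega=\operatorname{diag}(\Omega)^{1/2}$, $\bar\Omega=\omega^{-1}\Omega\,\omega^{-1}$, and assume that the correlation matrix $$\bar\Omega^*=\begin{pmatrix}\bar\Gamma&\Delta^\top\\ \Delta&\bar\Omega\end{pmatrix}$$ is positive definite. Then $\mathcal{SUT}_{d,m}(\xi,\Omega,\Delta,\tau,\bar\Gamma,\nu)$ is the law of $\xi+\omega Z$, where $Z$ has the conditional law of $U_1$ given $U_0+\tau>0$ (componentwise) and $(U_0^\top,U_1^\top)^\top\sim\mathcal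 T_{m+d}(0,\bar\Omega^*,\nu)$. **Proposition.** Let $Y=(Y_1^\top,Y_2^\top)^\top\sim\mathcal{SUT}_{d,m}(\xi,\Omega,\Delta,\tau,\bar\Gamma,\nu)$ with $Y_i\in\mathbb R^{d_i}$, $d=d_1+d_2$, and partition accordingly $$\xi=\begin{pmatrix}\xi_1\\ \xi_2\end{pmatrix},\quad \Omega=\begin{pmatrix}\Omega_{11}&\Omega_{12}\\ \Omega_{21}&\Omega_{22}\end{pmatrix},\quad \Delta=\begin{pmatrix}\Delta_1\\ \Delta_2\end{pmatrix},\qquad \omega_i=\operatorname{diag}(\Omega_{ii})^{1/2},\quad \bar\Omega_{11}=\omega_1^{-1}\Omega_{11}\omega_1^{-1}.$$ Then the laws $$(Y_2\mid Y_1=y_1)\sim\mathcal{SUT}_{d_2,m}\big(\xi_{2\cdot1},\ \alpha\,\Omega_{2\cdot1},\ \Delta_{2\cdot1},\ \alpha^{-1/2}\tau_{2\cdot1},\ \bar\Gamma_{2\cdot1},\ \nu+d_1\big),\qquad y_1\in\mathbb R^{d_1},$$ form a regular conditional distribution of $Y_2$ given $Y_1$, and for every $y_1\in\mathbb R^{d_1}$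 their parameters are admissible in the above sense. Here - $\xi_{2\cdot1}=\xi_2+\Omega_{21}\Omega_{11}^{-1}(y_1-\xi_1)$; - $\alpha=(\nu+Q_{y_1})/(\nu+d_1)$ with $Q_{y_1}=(y_1-\xi_1)^\top\Omega_{11}^{-1}(y_1-\xi_1)$; - $\Omega_{2\cdot1}=\Omega_{22}-\Omega_{21}\Omega_{11}^{-1}\Omega_{12}$ and $\omega_{2\cdot1}=\operatorname{diag}(\Omega_{2\cdot1})^{1/2}$; - $\Gamma_{2\cdot1}=\bar\Gamma-\Delta_1^\top\bar\Omega_{11}^{-1}\Delta_1$, $\gamma_{2\cdot1}=\operatorname{diag}(\Gamma_{2\cdot1})^{1/2}$ and $\bar\Gamma_{2\cdot1}=\gamma_{2\cdot1}^{-1}\Gamma_{2\cdot1}\gamma_{2\cdot1}^{-1}$; - $\Delta_{2\cdot1}=\omega_{2\cdot1}^{-1}\big(\omega_2\Delta_2-\Omega_{21}\Omega_{11}^{-1}\omega_1\Delta_1\big)\gamma_{2\cdot1}^{-1}$; - $\tau_{2\cdot1}=\gamma_{2\cdot1}^{-1}\big\{\tau+\Delta_1^\top\bar\Omega_{11}^{-1}\omega_1^{-1}(y_1-\xi_1)\big\}$.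 -/

import Mathlib

open MeasureTheory ProbabilityTheory Matrix

noncomputable section

namespace SUT

variable {ι κ : Type*} [Fintype ι] [DecidableEq ι] [Fintype κ] [DecidableEq κ]

/-- The density of the multivariate Student `t` distribution on `ℝ^ι` with location `ξ`,
dispersion matrix `S` (positive definite) and `ν > 0` degrees of freedom, where `d = |ι|`:
`Γ((ν+d)/2) / (Γ(ν/2) (πν)^{d/2}) · det(S)^{-1/2} · (1 + (x-ξ)ᵀ S⁻¹ (x-ξ) / ν)^{-(ν+d)/2}`. -/
def tPDF (ξ : ι → ℝ) (S : Matrix ι ι ℝ) (ν : ℝ) (x : ι → ℝ) : ℝ :=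
  Real.Gamma ((ν + Fintype.card ι) / 2) /
      (Real.Gamma (ν / 2) * (Real.pi * ν) ^ ((Fintype.card ι : ℝ) / 2)) *
    S.det ^ (-(1 / 2) : ℝ) *
    (1 + ((x - ξ) ⬝ᵥ (S⁻¹ *ᵥ (x - ξ))) / ν) ^ (-((ν + Fintype.card ι) / 2))

/-- The multivariate Student `t` distribution on `ℝ^ι`. -/
def multivariateT (ξ : ι → ℝ) (S : Matrix ι ι ℝ) (ν : ℝ) : Measure (ι → ℝ) :=
  volume.withDensity fun x => ENNReal.ofReal (tPDF ξ S ν x)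

/-- The diagonal matrix `diag(S)^{1/2}`. -/
def scale (S : Matrix ι ι ℝ) : Matrix ι ι ℝ :=
  Matrix.diagonal fun i => Real.sqrt (S i i)

/-- The matrix `s⁻¹ S s⁻¹` with `s = diag(S)^{1/2}`. -/
def standardize (S : Matrix ι ι ℝ) : Matrix ι ι ℝ :=
  (scale S)⁻¹ * S * (scale S)⁻¹

/-- The joint dispersion matrix of the latent vector `U₀` (indexed by `κ`) and `U₁`
(indexed by `ι`). -/
def jointCorr (Ω : Matrix ι ι ℝ) (Δ : Matrix ι κ ℝ) (Γ : Matrix κ κ ℝ) :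
    Matrix (κ ⊕ ι) (κ ⊕ ι) ℝ :=
  Matrix.fromBlocks Γ Δᵀ Δ (standardize Ω)

/-- The law of `ξ + ω Z`, `Z = (U₁ | U₀ + τ > 0)`, where `ω = diag(Ω)^{1/2}` and `(U₀, U₁)` has
the centred multivariate `t` distribution with dispersion matrix `jointCorr Ω Δ Γ` and
`ν` degrees of freedom. -/
def sutMeasure (ξ : ι → ℝ) (Ω : Matrix ι ι ℝ) (Δ : Matrix ι κ ℝ) (τ : κ → ℝ)
    (Γ : Matrix κ κ ℝ) (ν : ℝ) : Measure (ι → ℝ) :=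
  (ProbabilityTheory.cond (multivariateT 0 (jointCorr Ω Δ Γ) ν)
      {u : κ ⊕ ι → ℝ | ∀ k, 0 < u (Sum.inl k) + τ k}).map
    fun u => ξ + scale Ω *ᵥ fun i => u (Sum.inr i)

/-- `μ` is the law `SUT_{d,m}(ξ, Ω, Δ, τ, Γ, ν)`, with `d = |ι|` and `m = |κ|`: the parameters are
admissible (the joint dispersion matrix of the latent pair is a positive definite correlation
matrix, `ν > 0`) and `μ` is the law they define. The diagonal block `standardize Ω` of the joint
matrix has unit diagonal automatically, and positive definiteness forces `Ω` to be
positive definite. -/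
structure IsSUT (μ : Measure (ι → ℝ)) (ξ : ι → ℝ) (Ω : Matrix ι ι ℝ) (Δ : Matrix ι κ ℝ)
    (τ : κ → ℝ) (Γ : Matrix κ κ ℝ) (ν : ℝ) : Prop where
  df_pos : 0 < ν
  corr_diag : ∀ k, Γ k k = 1
  posDef : (jointCorr Ω Δ Γ).PosDef
  law_eq : μ = sutMeasure ξ Ω Δ τ Γ ν

/-! ### Parameters of the conditional law

The coordinates are indexed by `ι₁ ⊕ ι₂`; the index `1` refers to the coordinates in `ι₁`, the
index `2` to those in `ι₂`. -/

variable {ι₁ ι₂ : Type*} [Fintype ι₁] [DecidableEq ι₁] [Fintype ι₂] [DecidableEq ι₂]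

/-- `ξ_{2·1} = ξ₂ + Ω₂₁ Ω₁₁⁻¹ (y₁ - ξ₁)`. -/
def condLocation (ξ : ι₁ ⊕ ι₂ → ℝ) (Ω : Matrix (ι₁ ⊕ ι₂) (ι₁ ⊕ ι₂) ℝ) (y₁ : ι₁ → ℝ) : ι₂ → ℝ :=
  ξ ∘ Sum.inr + (Ω.toBlocks₂₁ * Ω.toBlocks₁₁⁻¹) *ᵥ (y₁ - ξ ∘ Sum.inl)

/-- `Q_{y₁} = (y₁ - ξ₁)ᵀ Ω₁₁⁻¹ (y₁ - ξ₁)`. -/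
def condQ (ξ : ι₁ ⊕ ι₂ → ℝ) (Ω : Matrix (ι₁ ⊕ ι₂) (ι₁ ⊕ ι₂) ℝ) (y₁ : ι₁ → ℝ) : ℝ :=
  (y₁ - ξ ∘ Sum.inl) ⬝ᵥ (Ω.toBlocks₁₁⁻¹ *ᵥ (y₁ - ξ ∘ Sum.inl))

/-- `α = (ν + Q_{y₁}) / (ν + d₁)`. -/
def condAlpha (ξ : ι₁ ⊕ ι₂ → ℝ) (Ω : Matrix (ι₁ ⊕ ι₂) (ι₁ ⊕ ι₂) ℝ) (ν : ℝ) (y₁ : ι₁ → ℝ) : ℝ :=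
  (ν + condQ ξ Ω y₁) / (ν + Fintype.card ι₁)

/-- `Ω_{2·1} = Ω₂₂ - Ω₂₁ Ω₁₁⁻¹ Ω₁₂`. -/
def condDispersion (Ω : Matrix (ι₁ ⊕ ι₂) (ι₁ ⊕ ι₂) ℝ) : Matrix ι₂ ι₂ ℝ :=
  Ω.toBlocks₂₂ - Ω.toBlocks₂₁ * Ω.toBlocks₁₁⁻¹ * Ω.toBlocks₁₂

/-- The unnormalised latent dispersion `Γ_{2·1} = Γ̄ - Δ₁ᵀ Ω̄₁₁⁻¹ Δ₁`. -/
def condLatent (Ω : Matrix (ι₁ ⊕ ι₂) (ι₁ ⊕ ι₂) ℝ) (Δ : Matrix (ι₁ ⊕ ι₂) κ ℝ)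
    (Γ : Matrix κ κ ℝ) : Matrix κ κ ℝ :=
  Γ - Δ.toRows₁ᵀ * (standardize Ω.toBlocks₁₁)⁻¹ * Δ.toRows₁

/-- `γ_{2·1} = diag(Γ_{2·1})^{1/2}`. -/
def condLatentScale (Ω : Matrix (ι₁ ⊕ ι₂) (ι₁ ⊕ ι₂) ℝ) (Δ : Matrix (ι₁ ⊕ ι₂) κ ℝ)
    (Γ : Matrix κ κ ℝ) : Matrix κ κ ℝ :=
  scale (condLatent Ω Δ Γ)

/-- `Γ̄_{2·1} = γ_{2·1}⁻¹ Γ_{2·1} γ_{2·1}⁻¹`. -/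
def condLatentCorr (Ω : Matrix (ι₁ ⊕ ι₂) (ι₁ ⊕ ι₂) ℝ) (Δ : Matrix (ι₁ ⊕ ι₂) κ ℝ)
    (Γ : Matrix κ κ ℝ) : Matrix κ κ ℝ :=
  (condLatentScale Ω Δ Γ)⁻¹ * condLatent Ω Δ Γ * (condLatentScale Ω Δ Γ)⁻¹

/-- `Δ_{2·1} = ω_{2·1}⁻¹ (ω₂ Δ₂ - Ω₂₁ Ω₁₁⁻¹ ω₁ Δ₁) γ_{2·1}⁻¹`, where
`ω_{2·1} = diag(Ω_{2·1})^{1/2}` and `ω_i = diag(Ω_{ii})^{1/2}`. -/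
def condSkewness (Ω : Matrix (ι₁ ⊕ ι₂) (ι₁ ⊕ ι₂) ℝ) (Δ : Matrix (ι₁ ⊕ ι₂) κ ℝ)
    (Γ : Matrix κ κ ℝ) : Matrix ι₂ κ ℝ :=
  (scale (condDispersion Ω))⁻¹ *
    (scale Ω.toBlocks₂₂ * Δ.toRows₂ -
      Ω.toBlocks₂₁ * Ω.toBlocks₁₁⁻¹ * scale Ω.toBlocks₁₁ * Δ.toRows₁) *
    (condLatentScale Ω Δ Γ)⁻¹

/-- `τ_{2·1} = γ_{2·1}⁻¹ (τ + Δ₁ᵀ Ω̄₁₁⁻¹ ω₁⁻¹ (y₁ - ξ₁))`. -/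
def condTruncation (ξ : ι₁ ⊕ ι₂ → ℝ) (Ω : Matrix (ι₁ ⊕ ι₂) (ι₁ ⊕ ι₂) ℝ)
    (Δ : Matrix (ι₁ ⊕ ι₂) κ ℝ) (τ : κ → ℝ) (Γ : Matrix κ κ ℝ) (y₁ : ι₁ → ℝ) : κ → ℝ :=
  (condLatentScale Ω Δ Γ)⁻¹ *ᵥ
    (τ + (Δ.toRows₁ᵀ * (standardize Ω.toBlocks₁₁)⁻¹ * (scale Ω.toBlocks₁₁)⁻¹) *ᵥ
      (y₁ - ξ ∘ Sum.inl))

end SUT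

end

/-!
The proof keeps the latent vector in view and never evaluates a normalizing constant.
`SUT.sutMeasure_eq_normalized` rewrites a `SUT` law: shift the latent coordinates by `τ`, so that
the truncation is to positive values, and rescale all coordinates by a positive diagonal matrix.
The law becomes the normalized marginal of an unnormalized `t` kernel `SUT.tKernel` restricted to
positive latent coordinates. The latent scale is arbitrary, since positivity does not see it.

With `y₁` observed, the quadratic form in the joint `t` kernel splits
(`SUT.dotProduct_inv_fromBlocks`) as `Q + R`, where `Q = Q_{y₁}` and `R` is the form of the Schur
complement of `Ω₁₁`, taken at the regression residual of the remaining coordinates. Now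
`1 + (Q + R) / ν = (1 + Q / ν) (1 + α⁻¹ R / (ν + d₁))`, and the exponent
`(ν + (m + d₁ + d₂)) / 2` equals `((ν + d₁) + (m + d₂)) / 2`. Hence, up to a factor that depends
on `y₁` only, the section of the joint kernel at `y₁` is a `t` kernel with `ν + d₁` degrees of
freedom and dispersion matrix `α` times the Schur complement (`SUT.tKernel_assemble`). The blocks
of the Schur complement are the unstandardized conditional parameters (`SUT.smul_condJointDisp`,
`SUT.elim_condLocation`), so by `SUT.sutMeasure_eq_normalized` again, now with latent scale
`√α γ_{2·1}`, the normalized section has the claimed `SUT` law as its marginal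
(`SUT.sutMeasure_cond`).

A measure with a density on a product space disintegrates along its normalized sections
(`SUT.fst_compProd_densityKernel`), provided every section has finite nonzero mass. Finiteness
follows from the bound `‖v‖² ≤ tr(S) vᵀ S⁻¹ v` and the integrability of `(1 + ‖v‖²)^{-r/2}` for
`r` larger than the dimension.
-/

namespace SUT

variable {ι κ : Type*} [Fintype ι] [DecidableEq ι] [Fintype κ] [DecidableEq κ]
variable {ι₁ ι₂ : Type*} [Fintype ι₁] [DecidableEq ι₁] [Fintype ι₂] [DecidableEq ι₂]

/-! ### Quadratic forms and Schur complements -/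

omit [DecidableEq κ] in
lemma schur_posDef {A : Matrix ι ι ℝ} {B : Matrix ι κ ℝ} {D : Matrix κ κ ℝ}
    (hM : (fromBlocks A B Bᵀ D).PosDef) : (D - Bᵀ * A⁻¹ * B).PosDef := by
  have hA : A.PosDef := hM.submatrix Sum.inl_injective
  have := hA.isUnit.invertible
  refine .of_dotProduct_mulVec_pos ?_ fun y hy => ?_
  · have h := (IsHermitian.fromBlocks₁₁ B D hA.1).1
    simp only [conjTranspose_eq_transpose_of_trivial] at h
    exact h hM.1
  -- The block form at `(-A⁻¹ B y, y)` is the form of the Schur complement at `y`.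
  · have h := hM.dotProduct_mulVec_pos (x := Sum.elim (-((A⁻¹ * B) *ᵥ y)) y) (fun h => hy (by
      funext i; simpa using congrFun h (Sum.inr i)))
    have e := schur_complement_eq₁₁ B D (-((A⁻¹ * B) *ᵥ y)) y hA.1
    simp only [conjTranspose_eq_transpose_of_trivial, neg_add_cancel, dotProduct_zero,
      zero_add] at e
    rwa [dotProduct_mulVec, e, ← dotProduct_mulVec] at h

/-- The inverse quadratic form of a block matrix splits into the form of the first block and the
form of its Schur complement, evaluated at the regression residual. -/
lemma dotProduct_inv_fromBlocks {A : Matrix ι ι ℝ} {B : Matrix ι κ ℝ} {D : Matrix κ κ ℝ}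
    (hM : (fromBlocks A B Bᵀ D).PosDef) (x : ι → ℝ) (y : κ → ℝ) :
    Sum.elim x y ⬝ᵥ ((fromBlocks A B Bᵀ D)⁻¹ *ᵥ Sum.elim x y) =
      x ⬝ᵥ (A⁻¹ *ᵥ x) + (y - (Bᵀ * A⁻¹) *ᵥ x) ⬝ᵥ
        ((D - Bᵀ * A⁻¹ * B)⁻¹ *ᵥ (y - (Bᵀ * A⁻¹) *ᵥ x)) := by
  have hA : A.PosDef := hM.submatrix Sum.inl_injective
  have hS := schur_posDef hM
  have hAu := (isUnit_iff_isUnit_det _).1 hA.isUnit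
  have hSu := (isUnit_iff_isUnit_det _).1 hS.isUnit
  have hMu := (isUnit_iff_isUnit_det _).1 hM.isUnit
  have := hA.isUnit.invertible
  -- Write the argument as the image of `w = (p, q)` under the block matrix.
  obtain ⟨w, hw⟩ : ∃ w, fromBlocks A B Bᵀ D *ᵥ w = Sum.elim x y :=
    ⟨(fromBlocks A B Bᵀ D)⁻¹ *ᵥ Sum.elim x y, by
      rw [mulVec_mulVec, mul_nonsing_inv _ hMu, one_mulVec]⟩
  obtain ⟨p, q, rfl⟩ : ∃ p q, w = Sum.elim p q := ⟨_, _, (Sum.elim_comp_inl_inr w).symm⟩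
  have hw' := hw
  rw [fromBlocks_mulVec] at hw'
  have hx : A *ᵥ p + B *ᵥ q = x := by
    simpa using congrArg (fun f => f ∘ Sum.inl) hw'
  have hy : Bᵀ *ᵥ p + D *ᵥ q = y := by
    simpa using congrArg (fun f => f ∘ Sum.inr) hw'
  have h1 : A⁻¹ *ᵥ x = p + (A⁻¹ * B) *ᵥ q := by
    rw [← hx, mulVec_add, mulVec_mulVec, nonsing_inv_mul _ hAu, one_mulVec, mulVec_mulVec]
  have h2 : y - (Bᵀ * A⁻¹) *ᵥ x = (D - Bᵀ * A⁻¹ * B) *ᵥ q := by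
    rw [← mulVec_mulVec, h1, ← hy, mulVec_add, sub_mulVec, mulVec_mulVec, Matrix.mul_assoc]
    abel
  have h3 : x = A *ᵥ (p + (A⁻¹ * B) *ᵥ q) := by
    rw [← h1, mulVec_mulVec, mul_nonsing_inv _ hAu, one_mulVec]
  have e := schur_complement_eq₁₁ B D p q hA.1
  simp only [conjTranspose_eq_transpose_of_trivial, star_trivial] at e
  rw [h1, h2, mulVec_mulVec _ (D - _)⁻¹, nonsing_inv_mul _ hSu, one_mulVec, ← hw,
    mulVec_mulVec _ (fromBlocks _ _ _ _)⁻¹, nonsing_inv_mul _ hMu, one_mulVec,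
    dotProduct_comm _ (Sum.elim p q), dotProduct_mulVec, e,
    dotProduct_comm (_ *ᵥ q) q, dotProduct_mulVec q]
  congr 1
  conv_rhs => rw [h3]
  rw [dotProduct_comm (A *ᵥ _), dotProduct_mulVec]

lemma dotProduct_inv_congr {D : Matrix ι ι ℝ} (hD : IsUnit D.det) (J : Matrix ι ι ℝ)
    (u : ι → ℝ) :
    (D *ᵥ u) ⬝ᵥ ((D * J * Dᵀ)⁻¹ *ᵥ (D *ᵥ u)) = u ⬝ᵥ (J⁻¹ *ᵥ u) := by
  have hD' : IsUnit Dᵀ.det := by rwa [det_transpose]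
  rw [Matrix.mul_inv_rev, Matrix.mul_inv_rev, mulVec_mulVec, Matrix.mul_assoc, Matrix.mul_assoc,
    nonsing_inv_mul _ hD, Matrix.mul_one, dotProduct_mulVec, ← vecMul_transpose, vecMul_vecMul,
    ← Matrix.mul_assoc, mul_nonsing_inv _ hD', Matrix.one_mul, ← dotProduct_mulVec]

lemma dotProduct_inv_submatrix (e : κ ≃ ι) (S : Matrix ι ι ℝ) (v : ι → ℝ) :
    (v ∘ e) ⬝ᵥ ((S.submatrix e e)⁻¹ *ᵥ (v ∘ e)) = v ⬝ᵥ (S⁻¹ *ᵥ v) := by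
  rw [inv_submatrix_equiv, submatrix_mulVec_equiv, Function.comp_assoc, Equiv.self_comp_symm,
    Function.comp_id, comp_equiv_dotProduct_comp_equiv]

lemma dotProduct_inv_nonneg {S : Matrix ι ι ℝ} (hS : S.PosDef) (v : ι → ℝ) :
    0 ≤ v ⬝ᵥ (S⁻¹ *ᵥ v) := by
  simpa using hS.inv.posSemidef.dotProduct_mulVec_nonneg v

/-! ### Scale matrices and the joint dispersion matrix -/

lemma isUnit_det_diagonal_of_pos {d : ι → ℝ} (hd : ∀ i, 0 < d i) :
    IsUnit (diagonal d).det := by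
  rw [det_diagonal, isUnit_iff_ne_zero]
  exact Finset.prod_ne_zero_iff.2 fun i _ => (hd i).ne'

omit [Fintype ι] in
lemma scale_smul {a : ℝ} (ha : 0 ≤ a) (S : Matrix ι ι ℝ) : scale (a • S) = √a • scale S := by
  rw [scale, scale, ← diagonal_smul]
  congr 1
  funext i
  simp [Real.sqrt_mul ha]

lemma isUnit_det_scale {S : Matrix ι ι ℝ} (hS : ∀ i, 0 < S i i) : IsUnit (scale S).det :=
  isUnit_det_diagonal_of_pos fun i => Real.sqrt_pos.2 (hS i)

lemma scale_mul_standardize_mul_scale {S : Matrix ι ι ℝ} (hS : ∀ i, 0 < S i i) :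
    scale S * standardize S * scale S = S := by
  have h := isUnit_det_scale hS
  rw [standardize, Matrix.mul_assoc, Matrix.mul_assoc, nonsing_inv_mul _ h, Matrix.mul_one,
    ← Matrix.mul_assoc, mul_nonsing_inv _ h, Matrix.one_mul]

lemma inv_standardize {S : Matrix ι ι ℝ} (hs : IsUnit (scale S).det) :
    (standardize S)⁻¹ = scale S * S⁻¹ * scale S := by
  rw [standardize, Matrix.mul_inv_rev, Matrix.mul_inv_rev, nonsing_inv_nonsing_inv _ hs,
    Matrix.mul_assoc]

/-- If a diagonal entry `S i i` is not positive, then `scale S` is singular, its inverse in the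
sense of Mathlib is `0`, and so is `standardize S`. -/
lemma diag_pos_of_standardize_posDef {S : Matrix ι ι ℝ} (hS : (standardize S).PosDef) (i : ι) :
    0 < S i i := by
  have hu : IsUnit (scale S).det := by
    by_contra h
    have := hS.diag_pos (i := i)
    simp [standardize, nonsing_inv_apply_not_isUnit _ h] at this
  rw [scale, det_diagonal, isUnit_iff_ne_zero, Finset.prod_ne_zero_iff] at hu
  have := hu i (Finset.mem_univ i)
  by_contra h
  exact this (Real.sqrt_eq_zero_of_nonpos (not_lt.1 h))

/-- The dispersion matrix of `(U₀, ω U₁)`, where `(U₀, U₁)` has dispersion matrix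
`jointCorr Ω Δ Γ` and `ω = diag(Ω)^{1/2}`. -/
noncomputable def jointDisp (Ω : Matrix ι ι ℝ) (Δ : Matrix ι κ ℝ) (Γ : Matrix κ κ ℝ) :
    Matrix (κ ⊕ ι) (κ ⊕ ι) ℝ :=
  fromBlocks Γ (scale Ω * Δ)ᵀ (scale Ω * Δ) Ω

/-- Rescaling the latent coordinates by `a` and the others by `diag(Ω)^{1/2}` undoes the
standardization of `Ω`. -/
lemma diagonal_mul_jointCorr (a : κ → ℝ) {Ω : Matrix ι ι ℝ} (hΩ : ∀ i, 0 < Ω i i)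
    (Δ : Matrix ι κ ℝ) (Γ : Matrix κ κ ℝ) :
    diagonal (Sum.elim a fun i => √(Ω i i)) * jointCorr Ω Δ Γ *
        (diagonal (Sum.elim a fun i => √(Ω i i)))ᵀ =
      fromBlocks (diagonal a * Γ * diagonal a) (scale Ω * Δ * diagonal a)ᵀ
        (scale Ω * Δ * diagonal a) Ω := by
  ext (k | i) (l | j)
  · simp [jointCorr]
  · simp [jointCorr, scale, mul_assoc]
  · simp [jointCorr, scale]
  · simpa [jointCorr, scale] using congrFun₂ (scale_mul_standardize_mul_scale hΩ) i j

lemma jointDisp_eq {Ω : Matrix ι ι ℝ} (hΩ : ∀ i, 0 < Ω i i) (Δ : Matrix ι κ ℝ)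
    (Γ : Matrix κ κ ℝ) :
    jointDisp Ω Δ Γ = diagonal (Sum.elim 1 fun i => √(Ω i i)) * jointCorr Ω Δ Γ *
        (diagonal (Sum.elim 1 fun i => √(Ω i i)))ᵀ := by
  rw [diagonal_mul_jointCorr 1 hΩ, jointDisp]
  simp [Pi.one_def]

lemma PosDef.diagonal_mul_mul_diagonal {J : Matrix ι ι ℝ} (hJ : J.PosDef) {d : ι → ℝ}
    (hd : ∀ i, 0 < d i) : (diagonal d * J * (diagonal d)ᵀ).PosDef := by
  have h := (isUnit_iff_isUnit_det _).2 (isUnit_det_diagonal_of_pos hd)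
  have := (h.posDef_star_right_conjugate_iff (x := J)).2 hJ
  simpa [star_eq_conjTranspose] using this

/-! ### Conditioning the joint dispersion matrix -/

/-- Moves the observed coordinates `ι₁` in front of the latent ones and of `ι₂`. -/
def frontEquiv (κ ι₁ ι₂ : Type*) : ι₁ ⊕ (κ ⊕ ι₂) ≃ κ ⊕ (ι₁ ⊕ ι₂) where
  toFun := Sum.elim (Sum.inr ∘ Sum.inl) (Sum.map id Sum.inr)
  invFun := Sum.elim (Sum.inr ∘ Sum.inl) (Sum.elim Sum.inl (Sum.inr ∘ Sum.inr))
  left_inv := by rintro (_ | _ | _) <;> rfl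
  right_inv := by rintro (_ | _ | _) <;> rfl

/-- The covariances of the observed coordinates with the latent ones and with `ι₂`. -/
noncomputable def crossDisp (Ω : Matrix (ι₁ ⊕ ι₂) (ι₁ ⊕ ι₂) ℝ) (Δ : Matrix (ι₁ ⊕ ι₂) κ ℝ) :
    Matrix ι₁ (κ ⊕ ι₂) ℝ :=
  fromCols (scale Ω.toBlocks₁₁ * Δ.toRows₁) Ω.toBlocks₁₂

/-- The Schur complement of the observed block `Ω₁₁` in `jointDisp Ω Δ Γ`. -/
noncomputable def condJointDisp (Ω : Matrix (ι₁ ⊕ ι₂) (ι₁ ⊕ ι₂) ℝ) (Δ : Matrix (ι₁ ⊕ ι₂) κ ℝ)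
    (Γ : Matrix κ κ ℝ) : Matrix (κ ⊕ ι₂) (κ ⊕ ι₂) ℝ :=
  jointDisp Ω.toBlocks₂₂ Δ.toRows₂ Γ -
    (crossDisp Ω Δ)ᵀ * Ω.toBlocks₁₁⁻¹ * crossDisp Ω Δ

omit [Fintype κ] [DecidableEq κ] in
lemma jointDisp_submatrix_frontEquiv {Ω : Matrix (ι₁ ⊕ ι₂) (ι₁ ⊕ ι₂) ℝ} (hΩ : Ω.IsHermitian)
    (Δ : Matrix (ι₁ ⊕ ι₂) κ ℝ) (Γ : Matrix κ κ ℝ) :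
    (jointDisp Ω Δ Γ).submatrix (frontEquiv κ ι₁ ι₂) (frontEquiv κ ι₁ ι₂) =
      fromBlocks Ω.toBlocks₁₁ (crossDisp Ω Δ) (crossDisp Ω Δ)ᵀ
        (jointDisp Ω.toBlocks₂₂ Δ.toRows₂ Γ) := by
  have h : ∀ i j, Ω i j = Ω j i := fun i j => by simpa using (hΩ.apply i j).symm
  ext (i | k | i) (j | l | j)
  all_goals simp [jointDisp, frontEquiv, crossDisp, scale, toBlocks₁₁, toBlocks₁₂, toBlocks₂₂,
    toRows₁, toRows₂]
  · exact mul_comm _ _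
  · exact h _ _

omit [Fintype ι₁] [Fintype ι₂] [DecidableEq ι₁] [DecidableEq ι₂] in
lemma transpose_toBlocks₁₂ {Ω : Matrix (ι₁ ⊕ ι₂) (ι₁ ⊕ ι₂) ℝ} (hΩ : Ω.IsHermitian) :
    Ω.toBlocks₁₂ᵀ = Ω.toBlocks₂₁ := by
  ext i j
  simpa [toBlocks₁₂, toBlocks₂₁] using hΩ.apply (Sum.inr i) (Sum.inl j)

omit [Fintype κ] [DecidableEq κ] in
lemma condJointDisp_eq_fromBlocks {Ω : Matrix (ι₁ ⊕ ι₂) (ι₁ ⊕ ι₂) ℝ} (hΩ : Ω.PosDef)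
    (Δ : Matrix (ι₁ ⊕ ι₂) κ ℝ) (Γ : Matrix κ κ ℝ) :
    condJointDisp Ω Δ Γ = fromBlocks (condLatent Ω Δ Γ)
      (scale Ω.toBlocks₂₂ * Δ.toRows₂ -
        Ω.toBlocks₂₁ * Ω.toBlocks₁₁⁻¹ * scale Ω.toBlocks₁₁ * Δ.toRows₁)ᵀ
      (scale Ω.toBlocks₂₂ * Δ.toRows₂ -
        Ω.toBlocks₂₁ * Ω.toBlocks₁₁⁻¹ * scale Ω.toBlocks₁₁ * Δ.toRows₁)
      (condDispersion Ω) := by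
  have hΩ₁ : Ω.toBlocks₁₁.PosDef := hΩ.submatrix Sum.inl_injective
  have h12 := transpose_toBlocks₁₂ hΩ.1
  have hs := isUnit_det_scale (S := Ω.toBlocks₁₁) fun i => hΩ₁.diag_pos
  have hst : (scale Ω.toBlocks₁₁)ᵀ = scale Ω.toBlocks₁₁ := diagonal_transpose _
  have hinv := inv_standardize hs
  have hit : (Ω.toBlocks₁₁⁻¹)ᵀ = Ω.toBlocks₁₁⁻¹ := by simpa using hΩ₁.inv.1.eq
  have h21 : Ω.toBlocks₂₁ᵀ = Ω.toBlocks₁₂ := by rw [← h12, transpose_transpose]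
  rw [condJointDisp, crossDisp, jointDisp, transpose_fromCols, Matrix.mul_assoc, mul_fromCols,
    fromRows_mul_fromCols, sub_eq_add_neg, fromBlocks_neg, fromBlocks_add]
  simp only [← sub_eq_add_neg, condLatent, condDispersion, hinv, transpose_sub, transpose_mul, hst,
    hit, h12, h21, Matrix.mul_assoc]

/-- Up to the factor `α`, the Schur complement is the dispersion matrix of the latent pair of the
conditional law, scaled back by `√α γ_{2·1}` and `√α ω_{2·1}`. -/
lemma smul_condJointDisp {Ω : Matrix (ι₁ ⊕ ι₂) (ι₁ ⊕ ι₂) ℝ} (hΩ : Ω.PosDef)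
    {Δ : Matrix (ι₁ ⊕ ι₂) κ ℝ} {Γ : Matrix κ κ ℝ} (hL : ∀ k, 0 < condLatent Ω Δ Γ k k)
    (hC : ∀ i, 0 < condDispersion Ω i i) {α : ℝ} (hα : 0 < α) :
    diagonal (Sum.elim (fun k => √α * √(condLatent Ω Δ Γ k k))
          fun i => √((α • condDispersion Ω) i i)) *
        jointCorr (α • condDispersion Ω) (condSkewness Ω Δ Γ) (condLatentCorr Ω Δ Γ) *
        (diagonal (Sum.elim (fun k => √α * √(condLatent Ω Δ Γ k k))
          fun i => √((α • condDispersion Ω) i i)))ᵀ = α • condJointDisp Ω Δ Γ := by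
  have hd : diagonal (fun k => √α * √(condLatent Ω Δ Γ k k)) = √α • condLatentScale Ω Δ Γ := by
    rw [condLatentScale, scale, ← diagonal_smul]
    rfl
  have hLu := isUnit_det_scale hL
  have hCu := isUnit_det_scale hC
  rw [diagonal_mul_jointCorr _ (fun i => by simpa using mul_pos hα (hC i)), hd,
    condJointDisp_eq_fromBlocks hΩ, fromBlocks_smul]
  have h1 : √α • condLatentScale Ω Δ Γ * condLatentCorr Ω Δ Γ * √α • condLatentScale Ω Δ Γ =
      α • condLatent Ω Δ Γ := by
    have := scale_mul_standardize_mul_scale hL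
    rw [smul_mul_assoc, smul_mul_assoc, mul_smul_comm, smul_smul, Real.mul_self_sqrt hα.le]
    exact congrArg _ this
  have h2 : scale (α • condDispersion Ω) * condSkewness Ω Δ Γ * √α • condLatentScale Ω Δ Γ =
      α • (scale Ω.toBlocks₂₂ * Δ.toRows₂ -
        Ω.toBlocks₂₁ * Ω.toBlocks₁₁⁻¹ * scale Ω.toBlocks₁₁ * Δ.toRows₁) := by
    rw [scale_smul hα.le, Matrix.smul_mul, Matrix.smul_mul, Matrix.mul_smul, smul_smul,
      Real.mul_self_sqrt hα.le, condSkewness, condLatentScale, ← Matrix.mul_assoc,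
      ← Matrix.mul_assoc, mul_nonsing_inv _ hCu, Matrix.one_mul, Matrix.mul_assoc,
      nonsing_inv_mul _ hLu, Matrix.mul_one]
  rw [h1, h2, transpose_smul]

/-! ### Normalized measures and conditional kernels given by densities -/

section Normalized

variable {α β : Type*} [MeasurableSpace α] [MeasurableSpace β]

/-- The measure `μ` divided by its total mass. -/
noncomputable def normalized (μ : Measure α) : Measure α := (μ Set.univ)⁻¹ • μ

lemma normalized_smul {c : ENNReal} (hc : c ≠ 0) (hc' : c ≠ ⊤) (μ : Measure α) :
    normalized (c • μ) = normalized μ := by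
  rw [normalized, normalized, smul_smul, Measure.smul_apply, smul_eq_mul,
    ENNReal.mul_inv (.inl hc) (.inl hc'), mul_right_comm, ENNReal.inv_mul_cancel hc hc', one_mul]

lemma map_normalized (μ : Measure α) {f : α → β} (hf : Measurable f) :
    (normalized μ).map f = normalized (μ.map f) := by
  rw [normalized, normalized, Measure.map_smul, Measure.map_apply hf .univ, Set.preimage_univ]

lemma cond_eq_normalized_restrict (μ : Measure α) (s : Set α) :
    ProbabilityTheory.cond μ s = normalized (μ.restrict s) := by
  rw [ProbabilityTheory.cond, normalized, Measure.restrict_apply_univ]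

variable (l : Measure β) [SFinite l] (F : α × β → ENNReal)

/-- The kernel `a ↦ F (a, ·) dl / ∫ F (a, b) dl(b)`. It is the zero kernel if the quotient is not
measurable, by the convention of `Kernel.withDensity`. -/
noncomputable def densityKernel : Kernel α β :=
  Kernel.withDensity (Kernel.const α l) fun a b => (∫⁻ b', F (a, b') ∂l)⁻¹ * F (a, b)

variable {F}

lemma densityKernel_apply (hF : Measurable F) (a : α) :
    densityKernel l F a = normalized (l.withDensity fun b => F (a, b)) := by
  have hm : Measurable (Function.uncurry fun a b => (∫⁻ b', F (a, b') ∂l)⁻¹ * F (a, b)) :=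
    ((hF.lintegral_prod_right'.comp measurable_fst).inv).mul hF
  rw [densityKernel, Kernel.withDensity_apply _ hm, Kernel.const_apply, normalized,
    withDensity_apply _ .univ, Measure.restrict_univ,
    ← withDensity_smul (f := fun b => F (a, b)) _ (hF.comp measurable_prodMk_left)]
  rfl

lemma isMarkovKernel_densityKernel (hF : Measurable F) (h0 : ∀ a, ∫⁻ b, F (a, b) ∂l ≠ 0)
    (htop : ∀ a, ∫⁻ b, F (a, b) ∂l ≠ ⊤) : IsMarkovKernel (densityKernel l F) := by
  refine ⟨fun a => ⟨?_⟩⟩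
  rw [densityKernel_apply l hF, normalized, Measure.smul_apply, smul_eq_mul,
    withDensity_apply _ .univ, Measure.restrict_univ, ENNReal.inv_mul_cancel (h0 a) (htop a)]

/-- A measure with a density on a product disintegrates into its first marginal and the
normalized sections of the density. -/
lemma fst_compProd_densityKernel (hF : Measurable F) (h0 : ∀ a, ∫⁻ b, F (a, b) ∂l ≠ 0)
    (htop : ∀ a, ∫⁻ b, F (a, b) ∂l ≠ ⊤) (n : Measure α) [SFinite n] :
    ((n.prod l).withDensity F).fst ⊗ₘ densityKernel l F = (n.prod l).withDensity F := by
  have := isMarkovKernel_densityKernel l hF h0 htop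
  have hZ : Measurable fun a => ∫⁻ b, F (a, b) ∂l := hF.lintegral_prod_right'
  have hfst : ((n.prod l).withDensity F).fst = n.withDensity fun a => ∫⁻ b, F (a, b) ∂l := by
    ext s hs
    rw [Measure.fst_apply hs, withDensity_apply _ (measurable_fst hs), withDensity_apply _ hs,
      ← Set.prod_univ, setLIntegral_prod _ hF.aemeasurable.restrict]
    simp
  rw [hfst]
  ext s hs
  rw [Measure.compProd_apply hs, withDensity_apply _ hs, ← lintegral_indicator hs,
    lintegral_prod _ (hF.indicator hs).aemeasurable,
    lintegral_withDensity_eq_lintegral_mul _ hZ (Kernel.measurable_kernel_prodMk_left hs)]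
  refine lintegral_congr fun a => ?_
  have hsa : MeasurableSet (Prod.mk a ⁻¹' s) := measurable_prodMk_left hs
  rw [Pi.mul_apply, densityKernel_apply l hF, normalized, Measure.smul_apply, smul_eq_mul,
    withDensity_apply _ .univ, Measure.restrict_univ, ← mul_assoc,
    ENNReal.mul_inv_cancel (h0 a) (htop a), one_mul, withDensity_apply _ hsa,
    ← lintegral_indicator hsa]
  rfl

end Normalized

/-! ### The truncated `t` kernel -/

/-- The density of the multivariate `t` distribution without its normalizing constant. -/
noncomputable def tKernel (ξ : ι → ℝ) (S : Matrix ι ι ℝ) (ν : ℝ) (v : ι → ℝ) : ENNReal :=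
  ENNReal.ofReal
    ((1 + ((v - ξ) ⬝ᵥ (S⁻¹ *ᵥ (v - ξ))) / ν) ^ (-((ν + Fintype.card ι) / 2)))

/-- The vectors whose latent coordinates are all positive. -/
def latentPos (κ ι : Type*) : Set (κ ⊕ ι → ℝ) := {v | ∀ k, 0 < v (Sum.inl k)}

/-- The unnormalized `t` distribution on `ℝ^(κ ⊕ ι)`, truncated to positive latent coordinates. -/
noncomputable def truncT (ξ : κ ⊕ ι → ℝ) (S : Matrix (κ ⊕ ι) (κ ⊕ ι) ℝ) (ν : ℝ) :
    Measure (κ ⊕ ι → ℝ) :=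
  (volume.restrict (latentPos κ ι)).withDensity (tKernel ξ S ν)

lemma measurable_tKernel (ξ : ι → ℝ) (S : Matrix ι ι ℝ) (ν : ℝ) : Measurable (tKernel ξ S ν) := by
  have : Measurable fun v : ι → ℝ => (v - ξ) ⬝ᵥ (S⁻¹ *ᵥ (v - ξ)) := by
    refine Continuous.measurable ?_
    have h : Continuous fun v : ι → ℝ => v - ξ := by fun_prop
    exact h.dotProduct (continuous_const.matrix_mulVec h)
  unfold tKernel
  fun_prop

omit [Fintype ι] [DecidableEq ι] [DecidableEq κ] in
lemma isOpen_latentPos : IsOpen (latentPos κ ι) := by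
  simp only [latentPos, Set.ofPred_forall]
  exact isOpen_iInter_of_finite fun k => isOpen_lt continuous_const (continuous_apply _)

omit [DecidableEq ι] [DecidableEq κ] in
lemma measurableSet_latentPos : MeasurableSet (latentPos κ ι) :=
  isOpen_latentPos.measurableSet

lemma tKernel_base_pos {S : Matrix ι ι ℝ} (hS : S.PosDef) {ν : ℝ} (hν : 0 < ν) (v : ι → ℝ) :
    0 < 1 + (v ⬝ᵥ (S⁻¹ *ᵥ v)) / ν := by
  have := div_nonneg (dotProduct_inv_nonneg hS v) hν.le
  linarith

lemma tKernel_pos (ξ : ι → ℝ) {S : Matrix ι ι ℝ} (hS : S.PosDef) {ν : ℝ} (hν : 0 < ν)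
    (v : ι → ℝ) : 0 < tKernel ξ S ν v :=
  ENNReal.ofReal_pos.2 (Real.rpow_pos_of_pos (tKernel_base_pos hS hν _) _)

/-- The Cauchy–Schwarz inequality `v_i² ≤ S_ii · vᵀ S⁻¹ v` for the inner product `S⁻¹`. -/
lemma sq_apply_le_mul_dotProduct_inv {S : Matrix ι ι ℝ} (hS : S.PosDef) (v : ι → ℝ) (i : ι) :
    v i ^ 2 ≤ S i i * (v ⬝ᵥ (S⁻¹ *ᵥ v)) := by
  have hSu := (isUnit_iff_isUnit_det _).1 hS.isUnit
  have hpos : 0 < S i i := hS.diag_pos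
  set t := v i / S i i with ht
  have hst : Sᵀ = S := by simpa using hS.1.eq
  -- The form is nonnegative at `v - t S e_i`; `t = v_i / S_ii` minimizes its value.
  have h := dotProduct_inv_nonneg hS (v - t • (S *ᵥ Pi.single i 1))
  have e1 : S⁻¹ *ᵥ (v - t • (S *ᵥ Pi.single i 1)) = S⁻¹ *ᵥ v - t • Pi.single i 1 := by
    rw [mulVec_sub, mulVec_smul, mulVec_mulVec, nonsing_inv_mul _ hSu, one_mulVec]
  have e2 : (S *ᵥ Pi.single i 1) ⬝ᵥ (S⁻¹ *ᵥ v) = v i := by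
    rw [← vecMul_transpose, hst, ← dotProduct_mulVec, mulVec_mulVec, mul_nonsing_inv _ hSu,
      one_mulVec, single_one_dotProduct]
  rw [e1, sub_dotProduct, dotProduct_sub, dotProduct_sub, smul_dotProduct, smul_dotProduct,
    e2, dotProduct_smul, dotProduct_smul, dotProduct_single_one, dotProduct_single_one] at h
  simp only [mulVec_single_one, col_apply, smul_eq_mul] at h
  have h2 : t * S i i = v i := by rw [ht, div_mul_cancel₀ _ hpos.ne']
  have h3 : 0 ≤ v ⬝ᵥ (S⁻¹ *ᵥ v) - t * v i := by
    rw [h2] at h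
    linarith
  nlinarith [mul_nonneg hpos.le h3]

lemma norm_sq_le_trace_mul {S : Matrix ι ι ℝ} (hS : S.PosDef) (v : ι → ℝ) :
    ‖v‖ ^ 2 ≤ S.trace * (v ⬝ᵥ (S⁻¹ *ᵥ v)) := by
  have hq := dotProduct_inv_nonneg hS v
  have htr : 0 ≤ S.trace := hS.posSemidef.trace_nonneg
  have : ‖v‖ ≤ √(S.trace * (v ⬝ᵥ (S⁻¹ *ᵥ v))) := by
    refine (pi_norm_le_iff_of_nonneg (Real.sqrt_nonneg _)).2 fun i => Real.abs_le_sqrt ?_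
    refine (sq_apply_le_mul_dotProduct_inv hS v i).trans (mul_le_mul_of_nonneg_right ?_ hq)
    exact Finset.single_le_sum (f := fun i => S i i) (fun j _ => hS.posSemidef.diag_nonneg)
      (Finset.mem_univ i)
  calc ‖v‖ ^ 2 ≤ √(S.trace * (v ⬝ᵥ (S⁻¹ *ᵥ v))) ^ 2 := by gcongr
    _ = _ := Real.sq_sqrt (mul_nonneg htr hq)

lemma lintegral_tKernel_lt_top (ξ : ι → ℝ) {S : Matrix ι ι ℝ} (hS : S.PosDef) {ν : ℝ}
    (hν : 0 < ν) : ∫⁻ v, tKernel ξ S ν v < ⊤ := by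
  set r : ℝ := ν + Fintype.card ι with hr
  have hr0 : 0 < r := by positivity
  have htr : 0 ≤ S.trace := hS.posSemidef.trace_nonneg
  -- With this `c`, `norm_sq_le_trace_mul` gives `c (1 + ‖v‖²) ≤ 1 + vᵀ S⁻¹ v / ν`.
  set c : ℝ := (1 + ν * S.trace)⁻¹ with hc
  have hc0 : 0 < c := by positivity
  have hc1 : c * (1 + ν * S.trace) = 1 := inv_mul_cancel₀ (by positivity)
  have key : ∀ v : ι → ℝ, tKernel 0 S ν v ≤
      ENNReal.ofReal (c ^ (-r / 2) * (1 + ‖v‖ ^ 2) ^ (-r / 2)) := by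
    intro v
    rw [tKernel, sub_zero, ← Real.mul_rpow hc0.le (by positivity), ← neg_div]
    refine ENNReal.ofReal_le_ofReal (Real.rpow_le_rpow_of_nonpos (by positivity) ?_ (by linarith))
    have h1 := norm_sq_le_trace_mul hS v
    have h2 := dotProduct_inv_nonneg hS v
    set q := v ⬝ᵥ (S⁻¹ *ᵥ v)
    have h3 : c * (S.trace * q) ≤ q / ν := by
      rw [le_div_iff₀ hν]
      nlinarith [mul_nonneg hc0.le h2]
    nlinarith [mul_le_mul_of_nonneg_left h1 hc0.le, mul_nonneg hc0.le (mul_nonneg hν.le htr)]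
  have hint : Integrable fun v : ι → ℝ => c ^ (-r / 2) * (1 + ‖v‖ ^ 2) ^ (-r / 2) :=
    (integrable_rpow_neg_one_add_norm_sq (by simp [hr, hν])).const_mul _
  calc ∫⁻ v, tKernel ξ S ν v = ∫⁻ v, tKernel 0 S ν (v - ξ) := by simp [tKernel]
    _ = ∫⁻ v, tKernel 0 S ν v := lintegral_sub_right_eq_self _ _
    _ ≤ _ := lintegral_mono key
    _ < ⊤ := hint.lintegral_lt_top

lemma truncT_univ_ne_top (ξ : κ ⊕ ι → ℝ) {S : Matrix (κ ⊕ ι) (κ ⊕ ι) ℝ} (hS : S.PosDef) {ν : ℝ}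
    (hν : 0 < ν) : truncT ξ S ν Set.univ ≠ ⊤ := by
  rw [truncT, withDensity_apply _ .univ, Measure.restrict_univ]
  exact ((setLIntegral_le_lintegral _ _).trans_lt (lintegral_tKernel_lt_top ξ hS hν)).ne

lemma truncT_univ_ne_zero (ξ : κ ⊕ ι → ℝ) {S : Matrix (κ ⊕ ι) (κ ⊕ ι) ℝ} (hS : S.PosDef) {ν : ℝ}
    (hν : 0 < ν) : truncT ξ S ν Set.univ ≠ 0 := by
  rw [truncT, withDensity_apply _ .univ, Measure.restrict_univ, ← pos_iff_ne_zero,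
    lintegral_pos_iff_support (measurable_tKernel ξ S ν)]
  have : Function.support (tKernel ξ S ν) = Set.univ :=
    Set.eq_univ_of_forall fun v => (tKernel_pos ξ hS hν v).ne'
  rw [this, Measure.restrict_apply_univ]
  exact isOpen_latentPos.measure_pos _ ⟨fun _ => 1, fun _ => one_pos⟩

/-! ### The `SUT` law as a normalized marginal of a truncated `t` kernel -/

lemma multivariateT_eq_smul (ξ : ι → ℝ) {S : Matrix ι ι ℝ} (hS : S.PosDef) {ν : ℝ}
    (hν : 0 < ν) : ∃ c : ENNReal, c ≠ 0 ∧ c ≠ ⊤ ∧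
      multivariateT ξ S ν = c • volume.withDensity (tKernel ξ S ν) := by
  set c : ℝ := Real.Gamma ((ν + Fintype.card ι) / 2) /
      (Real.Gamma (ν / 2) * (Real.pi * ν) ^ ((Fintype.card ι : ℝ) / 2)) *
    S.det ^ (-(1 / 2) : ℝ) with hc
  have hc0 : 0 < c := by
    have h1 : 0 < Real.Gamma ((ν + Fintype.card ι) / 2) := Real.Gamma_pos_of_pos (by positivity)
    have h2 : 0 < Real.Gamma (ν / 2) := Real.Gamma_pos_of_pos (by positivity)
    have h3 := Real.rpow_pos_of_pos hS.det_pos (-(1 / 2) : ℝ)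
    positivity
  refine ⟨ENNReal.ofReal c, (ENNReal.ofReal_pos.2 hc0).ne', ENNReal.ofReal_ne_top, ?_⟩
  rw [multivariateT, ← withDensity_smul _ (measurable_tKernel ξ S ν)]
  congr 1
  funext v
  rw [tPDF, Pi.smul_apply, smul_eq_mul, tKernel, ← ENNReal.ofReal_mul hc0.le]

lemma map_add_mulVec_volume {D : Matrix ι ι ℝ} (hD : IsUnit D.det) (b : ι → ℝ) :
    (volume : Measure (ι → ℝ)).map (fun u => b + D *ᵥ u) =
      ENNReal.ofReal |D.det⁻¹| • volume := by
  have h := Real.map_matrix_volume_pi_eq_smul_volume_pi hD.ne_zero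
  have hm : Measurable (toLin' D) := (toLin' D).continuous_of_finiteDimensional.measurable
  have : (fun u => b + D *ᵥ u) = (fun u => b + u) ∘ toLin' D := by
    funext u
    simp
  rw [this, ← Measure.map_map (measurable_const_add b) hm, h, Measure.map_smul,
    map_add_left_eq_self]

/-- The law `SUT(ξ, Ω, Δ, τ, Γ, ν)` is the marginal of a truncated `t` law whose latent
coordinates are shifted by `τ`, so that the truncation is to positive values, and rescaled by an
arbitrary positive vector `a`, which leaves that event unchanged. -/
lemma sutMeasure_eq_normalized (ξ : ι → ℝ) {Ω : Matrix ι ι ℝ} (Δ : Matrix ι κ ℝ) (τ : κ → ℝ)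
    (Γ : Matrix κ κ ℝ) {ν : ℝ} (hν : 0 < ν) (hJ : (jointCorr Ω Δ Γ).PosDef)
    (hΩ : ∀ i, 0 < Ω i i) {a : κ → ℝ} (ha : ∀ k, 0 < a k) {S : Matrix (κ ⊕ ι) (κ ⊕ ι) ℝ}
    (hS : diagonal (Sum.elim a fun i => √(Ω i i)) * jointCorr Ω Δ Γ *
        (diagonal (Sum.elim a fun i => √(Ω i i)))ᵀ = S) :
    sutMeasure ξ Ω Δ τ Γ ν =
      normalized ((truncT (Sum.elim (a * τ) ξ) S ν).map fun v => v ∘ Sum.inr) := by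
  set d : κ ⊕ ι → ℝ := Sum.elim a fun i => √(Ω i i) with hd
  have hdpos : ∀ i, 0 < d i := by
    rintro (k | i)
    · exact ha k
    · exact Real.sqrt_pos.2 (hΩ i)
  have hdu := isUnit_det_diagonal_of_pos hdpos
  set b : κ ⊕ ι → ℝ := Sum.elim (a * τ) ξ with hb
  set φ : (κ ⊕ ι → ℝ) → κ ⊕ ι → ℝ := fun u => b + diagonal d *ᵥ u with hφ
  have hφm : Measurable φ := by
    refine Continuous.measurable ?_
    exact continuous_const.add (continuous_const.matrix_mulVec continuous_id)
  have hr : Measurable fun v : κ ⊕ ι → ℝ => v ∘ (Sum.inr : ι → κ ⊕ ι) :=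
    measurable_pi_lambda _ fun i => measurable_pi_apply _
  obtain ⟨c, hc0, hctop, hc⟩ := multivariateT_eq_smul 0 hJ hν
  have hfun : (fun u : κ ⊕ ι → ℝ => ξ + scale Ω *ᵥ fun i => u (Sum.inr i)) =
      (fun v => v ∘ Sum.inr) ∘ φ := by
    funext u i
    simp [hφ, hb, hd, scale, mulVec_diagonal]
  have hset : {u : κ ⊕ ι → ℝ | ∀ k, 0 < u (Sum.inl k) + τ k} = φ ⁻¹' latentPos κ ι := by
    ext u
    refine forall_congr' fun k => ?_
    have : φ u (Sum.inl k) = a k * (u (Sum.inl k) + τ k) := by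
      simp [hφ, hb, hd, mulVec_diagonal]
      ring
    rw [this, mul_pos_iff_of_pos_left (ha k)]
  have hker : tKernel 0 (jointCorr Ω Δ Γ) ν = tKernel b S ν ∘ φ := by
    funext u
    simp only [tKernel, Function.comp_apply, sub_zero, hφ, add_sub_cancel_left, ← hS,
      dotProduct_inv_congr hdu]
  have hmap : (volume.withDensity (tKernel b S ν ∘ φ)).map φ =
      ENNReal.ofReal |(diagonal d).det⁻¹| • volume.withDensity (tKernel b S ν) := by
    rw [← withDensity_smul_measure, ← map_add_mulVec_volume hdu b]
    ext s hs
    rw [Measure.map_apply hφm hs, withDensity_apply _ (hφm hs), withDensity_apply _ hs,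
      setLIntegral_map hs (measurable_tKernel b S ν) hφm]
    rfl
  have hdet : ENNReal.ofReal |(diagonal d).det⁻¹| ≠ 0 :=
    (ENNReal.ofReal_pos.2 (abs_pos.2 (inv_ne_zero hdu.ne_zero))).ne'
  rw [sutMeasure, hfun, ← Measure.map_map hr hφm, cond_eq_normalized_restrict, hc,
    Measure.restrict_smul, normalized_smul hc0 hctop, map_normalized _ hφm, hset,
    ← Measure.restrict_map hφm measurableSet_latentPos, hker, hmap, Measure.restrict_smul,
    normalized_smul hdet ENNReal.ofReal_ne_top, map_normalized _ hr,
    restrict_withDensity measurableSet_latentPos, truncT]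

/-! ### Conditioning the truncated `t` kernel -/

/-- The vector of all coordinates with observed part `p.1` and remaining part `p.2`. -/
def assemble (p : (ι₁ → ℝ) × (κ ⊕ ι₂ → ℝ)) : κ ⊕ (ι₁ ⊕ ι₂) → ℝ :=
  Sum.elim p.1 p.2 ∘ (frontEquiv κ ι₁ ι₂).symm

omit [DecidableEq κ] [DecidableEq ι₁] [DecidableEq ι₂] in
lemma measurePreserving_assemble :
    MeasurePreserving (assemble (ι₁ := ι₁) (ι₂ := ι₂) (κ := κ)) volume volume := by
  have h1 := volume_measurePreserving_sumPiEquivProdPi_symm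
    (fun _ : ι₁ ⊕ (κ ⊕ ι₂) => ℝ)
  have h2 := volume_measurePreserving_piCongrLeft (fun _ : κ ⊕ (ι₁ ⊕ ι₂) => ℝ)
    (frontEquiv κ ι₁ ι₂)
  convert h2.comp h1 using 1
  funext p x
  obtain ⟨y, rfl⟩ := (frontEquiv κ ι₁ ι₂).surjective x
  rcases y with i | k | i <;> rfl

lemma truncT_eq_map_assemble (b : κ ⊕ (ι₁ ⊕ ι₂) → ℝ)
    (S : Matrix (κ ⊕ (ι₁ ⊕ ι₂)) (κ ⊕ (ι₁ ⊕ ι₂)) ℝ) (ν : ℝ) :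
    truncT b S ν = ((volume.prod (volume.restrict (latentPos κ ι₂))).withDensity
      (tKernel b S ν ∘ assemble)).map assemble := by
  have hm := measurePreserving_assemble (ι₁ := ι₁) (ι₂ := ι₂) (κ := κ)
  have hset : assemble ⁻¹' latentPos κ (ι₁ ⊕ ι₂) =
      (Set.univ : Set (ι₁ → ℝ)) ×ˢ latentPos κ ι₂ := by
    ext p
    simp [latentPos, assemble, frontEquiv]
  have hprod : (volume : Measure (ι₁ → ℝ)).prod (volume.restrict (latentPos κ ι₂)) =
      (volume : Measure ((ι₁ → ℝ) × (κ ⊕ ι₂ → ℝ))).restrict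
        (assemble ⁻¹' latentPos κ (ι₁ ⊕ ι₂)) := by
    rw [hset, Measure.volume_eq_prod, ← Measure.prod_restrict, Measure.restrict_univ]
  have hres := hm.restrict_preimage (measurableSet_latentPos (κ := κ) (ι := ι₁ ⊕ ι₂))
  rw [truncT, hprod]
  ext s hs
  rw [Measure.map_apply hm.measurable hs, withDensity_apply _ (hm.measurable hs),
    withDensity_apply _ hs, ← hres.map_eq,
    setLIntegral_map hs (measurable_tKernel b S ν) hm.measurable]
  rfl

/-- As a function of the remaining coordinates, the `t` kernel is proportional to a `t` kernel
with the conditional parameters and `ν + d₁` degrees of freedom. -/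
lemma tKernel_assemble (ξ : ι₁ ⊕ ι₂ → ℝ) {Ω : Matrix (ι₁ ⊕ ι₂) (ι₁ ⊕ ι₂) ℝ}
    (Δ : Matrix (ι₁ ⊕ ι₂) κ ℝ) (τ : κ → ℝ) (Γ : Matrix κ κ ℝ) {ν : ℝ} (hν : 0 < ν)
    (hΩ : Ω.PosDef) (hS : (jointDisp Ω Δ Γ).PosDef) (y₁ : ι₁ → ℝ) :
    ∃ c : ENNReal, c ≠ 0 ∧ c ≠ ⊤ ∧ ∀ v : κ ⊕ ι₂ → ℝ,
      tKernel (Sum.elim τ ξ) (jointDisp Ω Δ Γ) ν (assemble (y₁, v)) =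
        c * tKernel
          (Sum.elim τ (ξ ∘ Sum.inr) +
            ((crossDisp Ω Δ)ᵀ * Ω.toBlocks₁₁⁻¹) *ᵥ (y₁ - ξ ∘ Sum.inl))
          (condAlpha ξ Ω ν y₁ • condJointDisp Ω Δ Γ) (ν + Fintype.card ι₁) v := by
  have hΩ₁ : Ω.toBlocks₁₁.PosDef := hΩ.submatrix Sum.inl_injective
  have hblk := jointDisp_submatrix_frontEquiv hΩ.1 Δ Γ
  have hB : (fromBlocks Ω.toBlocks₁₁ (crossDisp Ω Δ) (crossDisp Ω Δ)ᵀ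
      (jointDisp Ω.toBlocks₂₂ Δ.toRows₂ Γ)).PosDef := by
    rw [← hblk]
    exact hS.submatrix (frontEquiv κ ι₁ ι₂).injective
  have hC : (condJointDisp Ω Δ Γ).PosDef := schur_posDef hB
  have hQ : 0 ≤ condQ ξ Ω y₁ := dotProduct_inv_nonneg hΩ₁ _
  have hνd : 0 < ν + Fintype.card ι₁ := by positivity
  set Q := condQ ξ Ω y₁ with hQdef
  set p : ℝ := (ν + Fintype.card (κ ⊕ (ι₁ ⊕ ι₂))) / 2 with hp
  have hbase : 0 < 1 + Q / ν := by positivity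
  refine ⟨ENNReal.ofReal ((1 + Q / ν) ^ (-p)),
    (ENNReal.ofReal_pos.2 (Real.rpow_pos_of_pos hbase _)).ne', ENNReal.ofReal_ne_top, fun v => ?_⟩
  have hp' : (ν + Fintype.card ι₁ + Fintype.card (κ ⊕ ι₂)) / 2 = p := by
    rw [hp]
    simp only [Fintype.card_sum]
    push_cast
    ring
  set w := v - (Sum.elim τ (ξ ∘ Sum.inr) +
    ((crossDisp Ω Δ)ᵀ * Ω.toBlocks₁₁⁻¹) *ᵥ (y₁ - ξ ∘ Sum.inl)) with hw
  have hR : 0 ≤ w ⬝ᵥ ((condJointDisp Ω Δ Γ)⁻¹ *ᵥ w) := dotProduct_inv_nonneg hC w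
  set R := w ⬝ᵥ ((condJointDisp Ω Δ Γ)⁻¹ *ᵥ w) with hRdef
  have hform : (assemble (y₁, v) - Sum.elim τ ξ) ⬝ᵥ
      ((jointDisp Ω Δ Γ)⁻¹ *ᵥ (assemble (y₁, v) - Sum.elim τ ξ)) = Q + R := by
    have hcomp : (assemble (y₁, v) - Sum.elim τ ξ) ∘ frontEquiv κ ι₁ ι₂ =
        Sum.elim (y₁ - ξ ∘ Sum.inl) (v - Sum.elim τ (ξ ∘ Sum.inr)) := by
      funext i
      rcases i with i | k | i <;> simp [assemble, frontEquiv]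
    rw [← dotProduct_inv_submatrix (frontEquiv κ ι₁ ι₂), hcomp, hblk,
      dotProduct_inv_fromBlocks hB, sub_sub]
    rfl
  have hα : 0 < condAlpha ξ Ω ν y₁ := by
    rw [condAlpha, ← hQdef]
    positivity
  have hinv : w ⬝ᵥ ((condAlpha ξ Ω ν y₁ • condJointDisp Ω Δ Γ)⁻¹ *ᵥ w) =
      (condAlpha ξ Ω ν y₁)⁻¹ * R := by
    have : (condAlpha ξ Ω ν y₁ • condJointDisp Ω Δ Γ)⁻¹ =
        (condAlpha ξ Ω ν y₁)⁻¹ • (condJointDisp Ω Δ Γ)⁻¹ := by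
      refine Matrix.inv_eq_left_inv ?_
      rw [smul_mul_smul_comm, nonsing_inv_mul _ ((isUnit_iff_isUnit_det _).1 hC.isUnit),
        inv_mul_cancel₀ hα.ne', one_smul]
    rw [this, smul_mulVec, dotProduct_smul, smul_eq_mul]
  rw [tKernel, tKernel, hform, ← hw, hinv, hp', ← hp, ← ENNReal.ofReal_mul (by positivity),
    ← Real.mul_rpow hbase.le (by positivity)]
  congr 2
  rw [condAlpha, ← hQdef]
  field_simp
  ring

/-! ### The conditional law -/

lemma posDef_of_jointCorr_posDef {Ω : Matrix ι ι ℝ} {Δ : Matrix ι κ ℝ} {Γ : Matrix κ κ ℝ}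
    (hJ : (jointCorr Ω Δ Γ).PosDef) :
    (∀ i, 0 < Ω i i) ∧ (jointDisp Ω Δ Γ).PosDef ∧ Ω.PosDef := by
  have hΩ : ∀ i, 0 < Ω i i :=
    diag_pos_of_standardize_posDef (hJ.submatrix Sum.inr_injective)
  have hS : (jointDisp Ω Δ Γ).PosDef := by
    rw [jointDisp_eq hΩ]
    refine PosDef.diagonal_mul_mul_diagonal hJ ?_
    rintro (k | i)
    · exact one_pos
    · exact Real.sqrt_pos.2 (hΩ i)
  exact ⟨hΩ, hS, hS.submatrix Sum.inr_injective⟩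

lemma condJointDisp_posDef_and_diag_pos {Ω : Matrix (ι₁ ⊕ ι₂) (ι₁ ⊕ ι₂) ℝ}
    {Δ : Matrix (ι₁ ⊕ ι₂) κ ℝ} {Γ : Matrix κ κ ℝ} (hJ : (jointCorr Ω Δ Γ).PosDef) :
    (condJointDisp Ω Δ Γ).PosDef ∧ (∀ k, 0 < condLatent Ω Δ Γ k k) ∧
      ∀ i, 0 < condDispersion Ω i i := by
  obtain ⟨-, hS, hΩ⟩ := posDef_of_jointCorr_posDef hJ
  have hC : (condJointDisp Ω Δ Γ).PosDef := by
    refine schur_posDef ?_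
    rw [← jointDisp_submatrix_frontEquiv hΩ.1]
    exact hS.submatrix (frontEquiv κ ι₁ ι₂).injective
  have h := condJointDisp_eq_fromBlocks hΩ Δ Γ
  refine ⟨hC, fun k => ?_, fun i => ?_⟩
  · have := hC.diag_pos (i := Sum.inl k)
    rwa [h] at this
  · have := hC.diag_pos (i := Sum.inr i)
    rwa [h] at this

omit [Fintype ι₂] [DecidableEq ι₂] in
lemma condAlpha_pos (ξ : ι₁ ⊕ ι₂ → ℝ) {Ω : Matrix (ι₁ ⊕ ι₂) (ι₁ ⊕ ι₂) ℝ} (hΩ : Ω.PosDef)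
    {ν : ℝ} (hν : 0 < ν) (y₁ : ι₁ → ℝ) : 0 < condAlpha ξ Ω ν y₁ := by
  have hΩ₁ : Ω.toBlocks₁₁.PosDef := hΩ.submatrix Sum.inl_injective
  have hQ : 0 ≤ condQ ξ Ω y₁ := dotProduct_inv_nonneg hΩ₁ _
  rw [condAlpha]
  positivity

/-- The parameters of the conditional law are admissible. -/
lemma jointCorr_cond_posDef {Ω : Matrix (ι₁ ⊕ ι₂) (ι₁ ⊕ ι₂) ℝ}
    {Δ : Matrix (ι₁ ⊕ ι₂) κ ℝ} {Γ : Matrix κ κ ℝ} (hJ : (jointCorr Ω Δ Γ).PosDef) {α : ℝ}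
    (hα : 0 < α) :
    (jointCorr (α • condDispersion Ω) (condSkewness Ω Δ Γ) (condLatentCorr Ω Δ Γ)).PosDef := by
  obtain ⟨hC, hL, hD⟩ := condJointDisp_posDef_and_diag_pos hJ
  have hΩ := (posDef_of_jointCorr_posDef hJ).2.2
  have h := hC.smul hα
  rw [← smul_condJointDisp hΩ hL hD hα] at h
  refine ((isUnit_iff_isUnit_det _).2
    (isUnit_det_diagonal_of_pos ?_)).posDef_star_right_conjugate_iff.1 h
  rintro (k | i)
  · exact mul_pos (Real.sqrt_pos.2 hα) (Real.sqrt_pos.2 (hL k))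
  · exact Real.sqrt_pos.2 (mul_pos hα (hD i))

omit [Fintype ι₂] [DecidableEq ι₂] in
lemma condLatentCorr_diag {Ω : Matrix (ι₁ ⊕ ι₂) (ι₁ ⊕ ι₂) ℝ}
    {Δ : Matrix (ι₁ ⊕ ι₂) κ ℝ} {Γ : Matrix κ κ ℝ} (hL : ∀ k, 0 < condLatent Ω Δ Γ k k) (k : κ) :
    condLatentCorr Ω Δ Γ k k = 1 := by
  have h := congrFun₂ (scale_mul_standardize_mul_scale hL) k k
  have hs := Real.sqrt_pos.2 (hL k)
  change standardize (condLatent Ω Δ Γ) k k = 1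
  simp only [scale, mul_diagonal, diagonal_mul] at h
  have h2 := Real.mul_self_sqrt (hL k).le
  have : √(condLatent Ω Δ Γ k k) * √(condLatent Ω Δ Γ k k) *
      (standardize (condLatent Ω Δ Γ) k k - 1) = 0 := by linear_combination h - h2
  rcases mul_eq_zero.1 this with h3 | h3
  · exact absurd h3 (mul_pos hs hs).ne'
  · linarith

omit [Fintype ι₂] [DecidableEq ι₂] in
/-- The location of the conditional truncated kernel: the latent block is the conditional
truncation vector, scaled back, and the other block is the conditional location. -/
lemma elim_condLocation (ξ : ι₁ ⊕ ι₂ → ℝ) {Ω : Matrix (ι₁ ⊕ ι₂) (ι₁ ⊕ ι₂) ℝ} (hΩ : Ω.PosDef)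
    {Δ : Matrix (ι₁ ⊕ ι₂) κ ℝ} (τ : κ → ℝ) {Γ : Matrix κ κ ℝ}
    (hL : ∀ k, 0 < condLatent Ω Δ Γ k k) (y₁ : ι₁ → ℝ) {α : ℝ} (hα : 0 < α) :
    Sum.elim ((fun k => √α * √(condLatent Ω Δ Γ k k)) *
        (α ^ (-(1 / 2) : ℝ) • condTruncation ξ Ω Δ τ Γ y₁)) (condLocation ξ Ω y₁) =
      Sum.elim τ (ξ ∘ Sum.inr) +
        ((crossDisp Ω Δ)ᵀ * Ω.toBlocks₁₁⁻¹) *ᵥ (y₁ - ξ ∘ Sum.inl) := by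
  have hΩ₁ : Ω.toBlocks₁₁.PosDef := hΩ.submatrix Sum.inl_injective
  have h12 := transpose_toBlocks₁₂ hΩ.1
  have hs := isUnit_det_scale (S := Ω.toBlocks₁₁) fun i => hΩ₁.diag_pos
  have hst : (scale Ω.toBlocks₁₁)ᵀ = scale Ω.toBlocks₁₁ := diagonal_transpose _
  have hcoef : Δ.toRows₁ᵀ * (standardize Ω.toBlocks₁₁)⁻¹ * (scale Ω.toBlocks₁₁)⁻¹ =
      (scale Ω.toBlocks₁₁ * Δ.toRows₁)ᵀ * Ω.toBlocks₁₁⁻¹ := by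
    rw [inv_standardize hs, transpose_mul, hst, Matrix.mul_assoc, Matrix.mul_assoc,
      Matrix.mul_assoc, mul_nonsing_inv _ hs, Matrix.mul_one, Matrix.mul_assoc]
  have hroot : √α * α ^ (-(1 / 2) : ℝ) = 1 := by
    rw [Real.sqrt_eq_rpow, ← Real.rpow_add hα]
    simp
  have hlat : (fun k => √α * √(condLatent Ω Δ Γ k k)) *
        (α ^ (-(1 / 2) : ℝ) • condTruncation ξ Ω Δ τ Γ y₁) =
      condLatentScale Ω Δ Γ *ᵥ condTruncation ξ Ω Δ τ Γ y₁ := by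
    funext k
    simp only [Pi.mul_apply, Pi.smul_apply, smul_eq_mul, condLatentScale, scale, mulVec_diagonal]
    linear_combination √(condLatent Ω Δ Γ k k) * condTruncation ξ Ω Δ τ Γ y₁ k * hroot
  have hLu : IsUnit (condLatentScale Ω Δ Γ).det := isUnit_det_scale hL
  rw [hlat, condTruncation, mulVec_mulVec, mul_nonsing_inv _ hLu, one_mulVec, hcoef,
    crossDisp, transpose_fromCols, fromRows_mul, fromRows_mulVec, h12, condLocation,
    Sum.elim_add_add]

/-- The law defined by the conditional parameters is the normalized marginal of the conditional
truncated kernel. -/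
lemma sutMeasure_cond (ξ : ι₁ ⊕ ι₂ → ℝ) {Ω : Matrix (ι₁ ⊕ ι₂) (ι₁ ⊕ ι₂) ℝ}
    {Δ : Matrix (ι₁ ⊕ ι₂) κ ℝ} (τ : κ → ℝ) {Γ : Matrix κ κ ℝ} {ν : ℝ} (hν : 0 < ν)
    (hJ : (jointCorr Ω Δ Γ).PosDef) (y₁ : ι₁ → ℝ) :
    sutMeasure (condLocation ξ Ω y₁) (condAlpha ξ Ω ν y₁ • condDispersion Ω)
        (condSkewness Ω Δ Γ)
        ((condAlpha ξ Ω ν y₁) ^ (-(1 / 2) : ℝ) • condTruncation ξ Ω Δ τ Γ y₁)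
        (condLatentCorr Ω Δ Γ) (ν + Fintype.card ι₁) =
      normalized ((truncT (Sum.elim τ (ξ ∘ Sum.inr) +
            ((crossDisp Ω Δ)ᵀ * Ω.toBlocks₁₁⁻¹) *ᵥ (y₁ - ξ ∘ Sum.inl))
          (condAlpha ξ Ω ν y₁ • condJointDisp Ω Δ Γ) (ν + Fintype.card ι₁)).map
        fun v => v ∘ Sum.inr) := by
  obtain ⟨-, -, hΩ⟩ := posDef_of_jointCorr_posDef hJ
  obtain ⟨-, hL, hD⟩ := condJointDisp_posDef_and_diag_pos hJ
  have hα := condAlpha_pos ξ hΩ hν y₁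
  rw [sutMeasure_eq_normalized _ _ _ _ (by positivity) (jointCorr_cond_posDef hJ hα)
    (fun i => mul_pos hα (hD i))
    (fun k => mul_pos (Real.sqrt_pos.2 hα) (Real.sqrt_pos.2 (hL k)))
    (smul_condJointDisp hΩ hL hD hα), elim_condLocation ξ hΩ τ hL y₁ hα]

end SUT

theorem mainTheorem2 {E : Type*} [MeasurableSpace E] (P : Measure E) [IsProbabilityMeasure P]
    (d₁ d₂ m : ℕ) (Y : E → Fin d₁ ⊕ Fin d₂ → ℝ) (hYm : AEMeasurable Y P)
    (ξ : Fin d₁ ⊕ Fin d₂ → ℝ) (Ω : Matrix (Fin d₁ ⊕ Fin d₂) (Fin d₁ ⊕ Fin d₂) ℝ)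
    (Δ : Matrix (Fin d₁ ⊕ Fin d₂) (Fin m) ℝ) (τ : Fin m → ℝ)
    (Γ : Matrix (Fin m) (Fin m) ℝ) (ν : ℝ)
    (hY : SUT.IsSUT (P.map Y) ξ Ω Δ τ Γ ν) :
    ∃ K : Kernel (Fin d₁ → ℝ) (Fin d₂ → ℝ),
      IsMarkovKernel K ∧
      HasCondDistrib (fun e j => Y e (Sum.inr j)) (fun e i => Y e (Sum.inl i)) K P ∧
      ∀ y₁ : Fin d₁ → ℝ,
        SUT.IsSUT (K y₁)
          (SUT.condLocation ξ Ω y₁)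
          (SUT.condAlpha ξ Ω ν y₁ • SUT.condDispersion Ω)
          (SUT.condSkewness Ω Δ Γ)
          ((SUT.condAlpha ξ Ω ν y₁) ^ (-(1 / 2) : ℝ) • SUT.condTruncation ξ Ω Δ τ Γ y₁)
          (SUT.condLatentCorr Ω Δ Γ)
          (ν + d₁) := by
  obtain ⟨hν, -, hJ, hlaw⟩ := hY
  obtain ⟨hΩpos, hS, hΩ⟩ := SUT.posDef_of_jointCorr_posDef hJ
  obtain ⟨hC, hL, hD⟩ := SUT.condJointDisp_posDef_and_diag_pos hJ
  set l : Measure (Fin m ⊕ Fin d₂ → ℝ) := volume.restrict (SUT.latentPos (Fin m) (Fin d₂)) with hl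
  set F : (Fin d₁ → ℝ) × (Fin m ⊕ Fin d₂ → ℝ) → ENNReal :=
    SUT.tKernel (Sum.elim τ ξ) (SUT.jointDisp Ω Δ Γ) ν ∘ SUT.assemble with hF
  have hFm : Measurable F :=
    (SUT.measurable_tKernel _ _ _).comp SUT.measurePreserving_assemble.measurable
  have hr : Measurable fun v : Fin m ⊕ Fin d₂ → ℝ => v ∘ (Sum.inr : Fin d₂ → Fin m ⊕ Fin d₂) :=
    measurable_pi_lambda _ fun i => measurable_pi_apply _
  -- Each section of `F` is a multiple of the conditional truncated kernel.
  have hsec : ∀ y₁, ∃ c : ENNReal, c ≠ 0 ∧ c ≠ ⊤ ∧ l.withDensity (fun v => F (y₁, v)) =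
      c • SUT.truncT (Sum.elim τ (ξ ∘ Sum.inr) +
            ((SUT.crossDisp Ω Δ)ᵀ * Ω.toBlocks₁₁⁻¹) *ᵥ (y₁ - ξ ∘ Sum.inl))
          (SUT.condAlpha ξ Ω ν y₁ • SUT.condJointDisp Ω Δ Γ) (ν + Fintype.card (Fin d₁)) := by
    intro y₁
    obtain ⟨c, hc0, hctop, hc⟩ := SUT.tKernel_assemble ξ Δ τ Γ hν hΩ hS y₁
    refine ⟨c, hc0, hctop, ?_⟩
    rw [SUT.truncT, ← withDensity_smul _ (SUT.measurable_tKernel _ _ _)]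
    congr 1
    funext v
    exact hc v
  have hνd : 0 < ν + Fintype.card (Fin d₁) := by positivity
  have hmass : ∀ y₁, ∫⁻ v, F (y₁, v) ∂l ≠ 0 ∧ ∫⁻ v, F (y₁, v) ∂l ≠ ⊤ := by
    intro y₁
    obtain ⟨c, hc0, hctop, hc⟩ := hsec y₁
    have hpd := hC.smul (SUT.condAlpha_pos ξ hΩ hν y₁)
    have h : ∫⁻ v, F (y₁, v) ∂l = l.withDensity (fun v => F (y₁, v)) Set.univ := by
      rw [withDensity_apply _ .univ, Measure.restrict_univ]
    rw [h, hc, Measure.smul_apply, smul_eq_mul]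
    exact ⟨mul_ne_zero hc0 (SUT.truncT_univ_ne_zero _ hpd hνd),
      ENNReal.mul_ne_top hctop (SUT.truncT_univ_ne_top _ hpd hνd)⟩
  have hK := SUT.isMarkovKernel_densityKernel l hFm (fun a => (hmass a).1) fun a => (hmass a).2
  refine ⟨(SUT.densityKernel l F).map fun v => v ∘ Sum.inr, Kernel.IsMarkovKernel.map _ hr, ?_,
    fun y₁ => ⟨by positivity, SUT.condLatentCorr_diag hL,
      SUT.jointCorr_cond_posDef hJ (SUT.condAlpha_pos ξ hΩ hν y₁), ?_⟩⟩
  · have hY1 : AEMeasurable (fun e i => Y e (Sum.inl i)) P :=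
      aemeasurable_pi_lambda _ fun i => (aemeasurable_pi_iff.1 hYm _)
    have hY2 : AEMeasurable (fun e i => Y e (Sum.inr i)) P :=
      aemeasurable_pi_lambda _ fun i => (aemeasurable_pi_iff.1 hYm _)
    set ρ := (volume.prod l).withDensity F with hρ
    have hdis : ρ.fst ⊗ₘ SUT.densityKernel l F = ρ :=
      SUT.fst_compProd_densityKernel l hFm (fun a => (hmass a).1) (fun a => (hmass a).2) volume
    have hgm : Measurable fun y : Fin d₁ ⊕ Fin d₂ → ℝ => (y ∘ Sum.inl, y ∘ Sum.inr) := by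
      refine Measurable.prodMk ?_ ?_ <;> exact measurable_pi_lambda _ fun i => measurable_pi_apply _
    have hrm : Measurable fun v : Fin m ⊕ (Fin d₁ ⊕ Fin d₂) → ℝ =>
        v ∘ (Sum.inr : Fin d₁ ⊕ Fin d₂ → _) :=
      measurable_pi_lambda _ fun i => measurable_pi_apply _
    have hprod : Measurable (Prod.map id (fun v => v ∘ Sum.inr) :
        (Fin d₁ → ℝ) × (Fin m ⊕ Fin d₂ → ℝ) → (Fin d₁ → ℝ) × (Fin d₂ → ℝ)) :=
      measurable_id.prodMap hr
    have hjoint : P.map (fun e => ((fun i => Y e (Sum.inl i)), fun i => Y e (Sum.inr i))) =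
        SUT.normalized (ρ.map (Prod.map id fun v => v ∘ Sum.inr)) := by
      have h1 : P.map (fun e => ((fun i => Y e (Sum.inl i)), fun i => Y e (Sum.inr i))) =
          (P.map Y).map fun y => (y ∘ Sum.inl, y ∘ Sum.inr) :=
        (AEMeasurable.map_map_of_aemeasurable hgm.aemeasurable hYm).symm
      rw [h1, hlaw, SUT.sutMeasure_eq_normalized ξ Δ τ Γ hν hJ hΩpos (a := 1) (fun _ => one_pos)
        (SUT.jointDisp_eq hΩpos Δ Γ).symm, one_mul, SUT.map_normalized _ hgm,
        Measure.map_map hgm hrm, SUT.truncT_eq_map_assemble,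
        Measure.map_map (hgm.comp hrm) SUT.measurePreserving_assemble.measurable]
      rfl
    have hcomp : ρ.map (Prod.map id fun v => v ∘ Sum.inr) =
        ρ.fst ⊗ₘ (SUT.densityKernel l F).map fun v => v ∘ Sum.inr := by
      rw [Measure.compProd_map hr, hdis]
    have hfst : P.map (fun e i => Y e (Sum.inl i)) =
        (ρ.map (Prod.map id (fun v => v ∘ Sum.inr) :
          (Fin d₁ → ℝ) × (Fin m ⊕ Fin d₂ → ℝ) → (Fin d₁ → ℝ) × (Fin d₂ → ℝ)) Set.univ)⁻¹ •
            ρ.fst := by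
      rw [← Measure.fst_map_prodMk₀ hY2 (X := fun e i => Y e (Sum.inl i)), hjoint, SUT.normalized,
        Measure.fst, Measure.map_smul, Measure.map_map measurable_fst hprod]
      rfl
    refine ⟨hY1.prodMk hY2, ?_⟩
    rw [hjoint, hfst, Measure.compProd_smul_left, ← hcomp]
    rfl
  · obtain ⟨c, hc0, hctop, hc⟩ := hsec y₁
    rw [Kernel.map_apply _ hr, SUT.densityKernel_apply l hFm, hc, SUT.normalized_smul hc0 hctop,
      SUT.map_normalized _ hr, ← SUT.sutMeasure_cond ξ τ hν hJ y₁, Fintype.card_fin]
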